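/- Let $(M,g)$ be a spacetime, that is, a smooth Hausdorff manifold (without boundary, of finite dimension) with a smooth Lorentzian metric $g$ of signature $(-,+,\dots,+)$ and a time orientation. A nonzero tangent vector $v$ is causal if $g(v,v)\le 0$. A future-directed (past-directed) causal curve is a curve $\gamma\colon I\to M$ on an interval $I$ that is locally Lipschitz with respect to any Riemannian metric and whose velocity $\dot\gamma$ is a future-directed (past-directed) causal vector almost everywhere; a causal curve is inextendible if it has no limit in $M$ at either end of $I$. Write $q\in J^+(p)$ if $q=p$ or there is a future-directed causal curve from $p$ to $q$. Let $h$ be a complete Riemannian metric on $M$, and let $\tau\colon M\to\mathbb{R}$ be a temporal function, that is, a smooth function whose gradient $\nabla\tau$ with respect to $g$ is past-directed timelike everywhere. Suppose that $\tau$ is $h$-steep, that is, $$d\tau(v)\ \ge\ \|v\|_h=\sqrt{h(v,v)}\qquad\text{for all future-directed causal vectors } v\in TM.$$ Then $\tau$ is a Cauchy time function: $\tau$ is continuous, $\tau(p)<\tau(q)$ whenever $q\in J^+(p)\setminus\{p\}$, and every inextendible (future- or past-directed) causal curve in $M$ intersects each level set $\tau^{-1}(s)$, $s\in\mathbb{R}$,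 exactly once. -/

import Mathlib

open Set Filter Topology MeasureTheory Bundle Manifold
open scoped ContDiff

noncomputable section

namespace NullDist

/-- The model space of `d`-dimensional manifolds. -/
abbrev Model (d : ℕ) : Type := EuclideanSpace ℝ (Fin d)

/-- A smooth Riemannian metric on the smooth `d`-dimensional manifold `M`. -/
abbrev RiemMetric (d : ℕ) (M : Type*) [TopologicalSpace M] [ChartedSpace (Model d) M]
    [IsManifold (𝓡 d) ∞ M] : Type _ :=
  ContMDiffRiemannianMetric (𝓡 d) ∞ (Model d) (fun x : M ↦ TangentSpace (𝓡 d) x)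

/-- A smooth Lorentzian metric: a smooth field of symmetric bilinear forms on the tangent spaces,
of signature `(-, +, …, +)`. -/
structure LorentzMetric (d : ℕ) (M : Type*) [TopologicalSpace M] [ChartedSpace (Model d) M]
    [IsManifold (𝓡 d) ∞ M] where
  /-- The bilinear form on each tangent space. -/
  inner (p : M) : TangentSpace (𝓡 d) p →L[ℝ] TangentSpace (𝓡 d) p →L[ℝ] ℝ
  symm (p : M) (v w : TangentSpace (𝓡 d) p) : inner p v w = inner p w v
  signature (p : M) : ∃ e : TangentSpace (𝓡 d) p, inner p e e < 0 ∧
    ∀ v : TangentSpace (𝓡 d) p, inner p e v = 0 → v ≠ 0 → 0 < inner p v v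
  contMDiff : ContMDiff (𝓡 d) ((𝓡 d).prod 𝓘(ℝ, Model d →L[ℝ] Model d →L[ℝ] ℝ)) ∞
    (fun p ↦ TotalSpace.mk' (Model d →L[ℝ] Model d →L[ℝ] ℝ)
      (E := fun p : M ↦ TangentSpace (𝓡 d) p →L[ℝ] TangentSpace (𝓡 d) p →L[ℝ] ℝ) p (inner p))

/-- A spacetime structure on `M`: a smooth Lorentzian metric together with a time orientation,
which is given by a continuous timelike vector field. -/
structure Spacetime (d : ℕ) (M : Type*) [TopologicalSpace M] [ChartedSpace (Model d) M]
    [IsManifold (𝓡 d) ∞ M] extends LorentzMetric d M where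
  /-- The vector field that determines the time orientation. -/
  orient (p : M) : TangentSpace (𝓡 d) p
  orient_timelike (p : M) : inner p (orient p) (orient p) < 0
  orient_continuous : Continuous fun p : M ↦ (⟨p, orient p⟩ : TangentBundle (𝓡 d) M)

variable {d : ℕ} {M : Type*} [TopologicalSpace M] [ChartedSpace (Model d) M]
  [IsManifold (𝓡 d) ∞ M]

/-! ### Riemannian notions -/

/-- The norm `‖v‖_h = √(h(v, v))` of a tangent vector. -/
def riemNorm (h : RiemMetric d M) {p : M} (v : TangentSpace (𝓡 d) p) : ℝ :=
  Real.sqrt (h.inner p v v)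

/-- `M` with the Riemannian distance `d_h`, the infimum of the `h`-lengths of `C^1` paths between
two points (it is `∞` between different components of `M`). Its topology is that of `M`. -/
@[reducible] def riemDist [T2Space M] (h : RiemMetric d M) : EMetricSpace M :=
  letI : RiemannianBundle (fun x : M ↦ TangentSpace (𝓡 d) x) := ⟨h.toRiemannianMetric⟩
  haveI : LocallyCompactSpace M := Manifold.locallyCompact_of_finiteDimensional (𝓡 d)
  haveI : IsManifold (𝓡 d) 1 M := IsManifold.of_le (n := ∞) (by simp)
  haveI : IsContinuousRiemannianBundle (Model d) (fun x : M ↦ TangentSpace (𝓡 d) x) :=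
    ⟨⟨h.inner, h.contMDiff.continuous, fun _ _ _ ↦ rfl⟩⟩
  EMetricSpace.ofRiemannianMetric (𝓡 d) M

/-- The Riemannian metric `h` is complete: `(M, d_h)` is a complete metric space. -/
def IsCompleteMetric [T2Space M] (h : RiemMetric d M) : Prop :=
  letI : EMetricSpace M := riemDist h
  CompleteSpace M

/-! ### Causal structure -/

namespace Spacetime

variable (g : Spacetime d M)

/-- `v` is timelike. -/
def IsTimelike {p : M} (v : TangentSpace (𝓡 d) p) : Prop :=
  g.inner p v v < 0

/-- `v` is causal, that is, timelike or null (and nonzero). -/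
def IsCausal {p : M} (v : TangentSpace (𝓡 d) p) : Prop :=
  g.inner p v v ≤ 0 ∧ v ≠ 0

/-- `v` is a future-directed causal vector. -/
def IsFutureCausal {p : M} (v : TangentSpace (𝓡 d) p) : Prop :=
  g.IsCausal v ∧ g.inner p (g.orient p) v < 0

/-- `v` is a past-directed causal vector. -/
def IsPastCausal {p : M} (v : TangentSpace (𝓡 d) p) : Prop :=
  g.IsCausal v ∧ 0 < g.inner p (g.orient p) v

/-- The velocity of a curve at the parameter `t`. -/
def velocity (γ : ℝ → M) (t : ℝ) : TangentSpace (𝓡 d) (γ t) :=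
  mfderiv 𝓘(ℝ, ℝ) (𝓡 d) γ t (1 : ℝ)

/-- The curve `γ` is locally Lipschitz on `s` with respect to any Riemannian metric. -/
def IsLocLipschitzCurve (d : ℕ) {M : Type*} [TopologicalSpace M] [ChartedSpace (Model d) M]
    [IsManifold (𝓡 d) ∞ M] [T2Space M] (γ : ℝ → M) (s : Set ℝ) : Prop :=
  ∀ k : RiemMetric d M, letI : EMetricSpace M := riemDist k
    LocallyLipschitzOn s γ

/-- `γ`, restricted to the interval `s`, is a future-directed causal curve: it is locally Lipschitz
and almost everywhere has a velocity, which is a future-directed causal vector. -/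
def IsFutureCausalCurveOn [T2Space M] (γ : ℝ → M) (s : Set ℝ) : Prop :=
  IsLocLipschitzCurve d γ s ∧
    ∀ᵐ t ∂volume.restrict s, MDifferentiableAt 𝓘(ℝ, ℝ) (𝓡 d) γ t ∧
      g.IsFutureCausal (velocity γ t)

/-- `γ`, restricted to the interval `s`, is a past-directed causal curve. -/
def IsPastCausalCurveOn [T2Space M] (γ : ℝ → M) (s : Set ℝ) : Prop :=
  IsLocLipschitzCurve d γ s ∧
    ∀ᵐ t ∂volume.restrict s, MDifferentiableAt 𝓘(ℝ, ℝ) (𝓡 d) γ t ∧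
      g.IsPastCausal (velocity γ t)

/-- `γ`, restricted to the nonempty interval `s`, is an inextendible (future- or past-directed)
causal curve: it has no endpoint in `M`, that is, `γ t` does not converge in `M` when `t` tends to
either end of `s`. (Such an `s` has no greatest and no least element, so it is an open interval.) -/
def IsInextendibleCausalCurveOn [T2Space M] (γ : ℝ → M) (s : Set ℝ) : Prop :=
  s.Nonempty ∧ s.OrdConnected ∧
    (g.IsFutureCausalCurveOn γ s ∨ g.IsPastCausalCurveOn γ s) ∧
    (¬ ∃ p : M, Tendsto (fun t : s ↦ γ t) atTop (𝓝 p)) ∧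
    (¬ ∃ p : M, Tendsto (fun t : s ↦ γ t) atBot (𝓝 p))

/-- The causal relation: `q ∈ J⁺(p)` when `q = p` or there is a future-directed causal curve
from `p` to `q`. -/
def causalFuture [T2Space M] (p : M) : Set M :=
  {q | q = p ∨ ∃ (a b : ℝ) (γ : ℝ → M), a < b ∧ g.IsFutureCausalCurveOn γ (Icc a b) ∧
    γ a = p ∧ γ b = q}

/-! ### Time functions -/

/-- A time function: continuous and strictly increasing along the causal relation. -/
def IsTimeFunction [T2Space M] (τ : M → ℝ) : Prop :=
  Continuous τ ∧ ∀ p q : M, q ∈ g.causalFuture p \ {p} → τ p < τ q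

/-- A Cauchy time function: a time function each of whose level sets is intersected exactly once
by every inextendible causal curve. -/
def IsCauchyTimeFunction [T2Space M] (τ : M → ℝ) : Prop :=
  g.IsTimeFunction τ ∧
    ∀ (γ : ℝ → M) (s : Set ℝ), g.IsInextendibleCausalCurveOn γ s →
      ∀ c : ℝ, ∃! t : ℝ, t ∈ s ∧ τ (γ t) = c

/-- The differential `dτ(v)` of a real function in the direction of a tangent vector. -/
def diff (τ : M → ℝ) {p : M} (v : TangentSpace (𝓡 d) p) : ℝ :=
  mfderiv (𝓡 d) 𝓘(ℝ, ℝ) τ p v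

/-- A Lorentzian metric is nondegenerate. -/
theorem eq_zero_of_inner_eq_zero (p : M) (w : TangentSpace (𝓡 d) p)
    (hw : ∀ v : TangentSpace (𝓡 d) p, g.inner p w v = 0) : w = 0 := by
  obtain ⟨e, -, he⟩ := g.signature p
  by_contra h
  have h1 := he w (by rw [g.symm, hw]) h
  rw [hw] at h1
  exact lt_irrefl _ h1

/-- The metric identifies tangent and cotangent spaces. -/
theorem exists_gradient (τ : M → ℝ) (p : M) :
    ∃ w : TangentSpace (𝓡 d) p, ∀ v : TangentSpace (𝓡 d) p, g.inner p w v = diff τ v := by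
  have : FiniteDimensional ℝ (TangentSpace (𝓡 d) p) :=
    inferInstanceAs (FiniteDimensional ℝ (Model d))
  let B : TangentSpace (𝓡 d) p →ₗ[ℝ] Module.Dual ℝ (TangentSpace (𝓡 d) p) :=
    (ContinuousLinearMap.coeLM ℝ).comp (g.inner p).toLinearMap
  have hinj : Function.Injective B := by
    rw [injective_iff_map_eq_zero]
    intro w hw
    exact g.eq_zero_of_inner_eq_zero p w fun v ↦ LinearMap.congr_fun hw v
  have hsurj : Function.Surjective B :=
    (LinearMap.injective_iff_surjective_of_finrank_eq_finrank
      (Subspace.dual_finrank_eq (K := ℝ)).symm).1 hinj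
  obtain ⟨w, hw⟩ := hsurj (mfderiv (𝓡 d) 𝓘(ℝ, ℝ) τ p).toLinearMap
  exact ⟨w, fun v ↦ LinearMap.congr_fun hw v⟩

/-- The gradient `∇τ` with respect to the Lorentzian metric: the vector with
`g(∇τ, v) = dτ(v)` for all `v`. -/
def gradient (τ : M → ℝ) (p : M) : TangentSpace (𝓡 d) p :=
  (g.exists_gradient τ p).choose

theorem inner_gradient (τ : M → ℝ) (p : M) (v : TangentSpace (𝓡 d) p) :
    g.inner p (g.gradient τ p) v = diff τ v :=
  (g.exists_gradient τ p).choose_spec v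

/-- A temporal function: a smooth function with past-directed timelike gradient. -/
def IsTemporal (τ : M → ℝ) : Prop :=
  ContMDiff (𝓡 d) 𝓘(ℝ, ℝ) ∞ τ ∧
    ∀ p : M, g.IsTimelike (g.gradient τ p) ∧ g.IsPastCausal (g.gradient τ p)

/-- The function `τ` is `h`-steep: `dτ(v) ≥ ‖v‖_h` for all future-directed causal vectors `v`. -/
def IsSteep (h : RiemMetric d M) (τ : M → ℝ) : Prop :=
  ∀ (p : M) (v : TangentSpace (𝓡 d) p), g.IsFutureCausal v → riemNorm h v ≤ diff τ v

end Spacetime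

end NullDist

end

/-! Steepness says that along a future-directed causal curve `γ` the function `τ ∘ γ` grows at least
as fast as `γ` moves in the metric `h`. Integrated, this is the estimate d_h(γ a, γ b) ≤ τ(γ b) -
τ(γ a), `riemDist_le_of_riemNorm_le_diff`, on which everything rests. If the right side is not
positive, the endpoints coincide, so `τ` is a time function. If `τ` were bounded above along an
inextendible curve, the monotone function `τ ∘ γ` would converge, `γ` would be Cauchy, and
completeness would give an endpoint; likewise below. Hence every value is attained, by the
intermediate value theorem. A value attained twice would make `γ` constant in between, against its
nonzero velocity. The curves are merely Lipschitz, while d_h is an infimum over C^1 paths. So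
instead of comparing lengths, one differentiates t ↦ d_h(γ a, γ t): its derivative is at most the
metric speed of `γ`, which `eventually_riemannianEDist_le_of_mdifferentiableAt` bounds by the norm
of the velocity. -/

namespace NullDist
open scoped NNReal ENNReal

/-! ### Integrating a bound on metric speed -/

/-- A Lipschitz function whose derivative is almost everywhere nonpositive is nonincreasing. -/
theorem le_of_lipschitzOnWith_of_ae_deriv_nonpos {G : ℝ → ℝ} {K : ℝ≥0} {a b : ℝ} (hab : a ≤ b)
    (hG : LipschitzOnWith K G (Icc a b))
    (h : ∀ᵐ t ∂volume.restrict (Ioo a b), deriv G t ≤ 0) : G b ≤ G a := by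
  have hac : AbsolutelyContinuousOnInterval G a b :=
    LipschitzOnWith.absolutelyContinuousOnInterval (by rwa [uIcc_of_le hab])
  have h1 := hac.integral_deriv_eq_sub
  have h2 : ∫ t in a..b, deriv G t ≤ 0 := by
    rw [intervalIntegral.integral_of_le hab, integral_Ioc_eq_integral_Ioo]
    exact integral_nonpos_of_ae h
  linarith

theorem deriv_le_of_eventually_sub_le {D : ℝ → ℝ} {t c : ℝ} (hD : DifferentiableAt ℝ D t)
    (h : ∀ᶠ s in 𝓝[>] t, D s - D t ≤ c * (s - t)) : deriv D t ≤ c := by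
  have h1 : Tendsto (slope D t) (𝓝[>] t) (𝓝 (deriv D t)) :=
    hD.hasDerivAt.tendsto_slope.mono_left (nhdsWithin_mono _ fun s hs ↦ ne_of_gt hs)
  refine le_of_tendsto h1 ?_
  filter_upwards [h, self_mem_nhdsWithin] with s hs hst
  rw [slope_def_field, div_le_iff₀ (sub_pos.2 hst)]
  exact hs

section PseudoEMetric

variable {X : Type*} [PseudoEMetricSpace X]

/-- The last hypothesis says that the metric speed of `γ` at `t` is at most `deriv F t`. By the
triangle inequality this bounds the derivative of D(t) = d(γ a, γ t) as well, so `D - F` is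
nonincreasing. -/
theorem edist_le_ofReal_sub_of_lipschitzOnWith {γ : ℝ → X} {F : ℝ → ℝ} {K L : ℝ≥0} {a b : ℝ}
    (hab : a ≤ b) (hγ : LipschitzOnWith K γ (Icc a b)) (hF : LipschitzOnWith L F (Icc a b))
    (h : ∀ᵐ t ∂volume.restrict (Ioo a b), DifferentiableAt ℝ F t ∧ 0 ≤ deriv F t ∧
      ∀ c > deriv F t, ∀ᶠ s in 𝓝 t, edist (γ t) (γ s) ≤ ENNReal.ofReal (c * |s - t|)) :
    edist (γ a) (γ b) ≤ ENNReal.ofReal (F b - F a) := by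
  -- The distance may be infinite in general; the Lipschitz bound keeps it finite along `γ`, so
  -- `toReal` loses nothing.
  have hfin : ∀ x ∈ Icc a b, ∀ y ∈ Icc a b, edist (γ x) (γ y) ≠ ⊤ := fun x hx y hy ↦
    ((hγ hx hy).trans_lt (ENNReal.mul_lt_top ENNReal.coe_lt_top (edist_lt_top _ _))).ne
  have ha : a ∈ Icc a b := left_mem_Icc.2 hab
  set D : ℝ → ℝ := fun t ↦ (edist (γ a) (γ t)).toReal with hDdef
  have htri : ∀ x ∈ Icc a b, ∀ y ∈ Icc a b, D y - D x ≤ (edist (γ x) (γ y)).toReal := by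
    intro x hx y hy
    have := ENNReal.toReal_mono (ENNReal.add_ne_top.2 ⟨hfin a ha x hx, hfin x hx y hy⟩)
      (edist_triangle (γ a) (γ x) (γ y))
    rw [ENNReal.toReal_add (hfin a ha x hx) (hfin x hx y hy)] at this
    simp only [hDdef]
    linarith
  have hD : LipschitzOnWith K D (Icc a b) := by
    refine LipschitzOnWith.of_le_add_mul K fun x hx y hy ↦ ?_
    have h1 := htri y hy x hx
    have h2 := ENNReal.toReal_mono (ENNReal.mul_ne_top ENNReal.coe_ne_top (edist_ne_top _ _))
      (hγ hy hx)
    rw [ENNReal.toReal_mul, ENNReal.coe_toReal, edist_dist,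
      ENNReal.toReal_ofReal dist_nonneg, dist_comm] at h2
    linarith
  have key := le_of_lipschitzOnWith_of_ae_deriv_nonpos (G := fun t ↦ D t - F t) hab
    (hD.sub hF) ?_
  · have hDa : D a = 0 := by simp [hDdef]
    refine (ENNReal.le_ofReal_iff_toReal_le (hfin a ha b (right_mem_Icc.2 hab)) ?_).2 ?_
    · have : 0 ≤ D b := ENNReal.toReal_nonneg
      linarith
    change D b ≤ _
    linarith
  filter_upwards [h, ae_restrict_mem measurableSet_Ioo] with t ⟨hFt, hF0, hc⟩ ht
  by_cases hG : DifferentiableAt ℝ (fun t ↦ D t - F t) t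
  · have hDt : DifferentiableAt ℝ D t := by
      have := hG.add hFt
      rwa [show (fun t ↦ D t - F t) + F = D by ext; simp] at this
    rw [deriv_fun_sub hDt hFt, sub_nonpos]
    refine le_of_forall_gt_imp_ge_of_dense fun c hcgt ↦ ?_
    refine deriv_le_of_eventually_sub_le hDt ?_
    filter_upwards [(hc c hcgt).filter_mono nhdsWithin_le_nhds, self_mem_nhdsWithin,
      nhdsWithin_le_nhds (Icc_mem_nhds ht.1 ht.2)] with s hs hst hsI
    have hst' : 0 ≤ s - t := sub_nonneg.2 (le_of_lt hst)
    rw [abs_of_nonneg hst'] at hs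
    refine (htri t ⟨ht.1.le, ht.2.le⟩ s hsI).trans (ENNReal.toReal_le_of_le_ofReal ?_ hs)
    exact mul_nonneg (hF0.trans hcgt.le) hst'
  -- Here `deriv` is zero by convention, so differentiability of `D` never has to be proved.
  · rw [deriv_zero_of_not_differentiableAt hG]

/-- Continuous induction: the parameters satisfying the estimate form a closed set, and the
Lipschitz case on a short interval to the right of any of them extends it by the triangle
inequality. -/
theorem edist_le_ofReal_sub_of_locallyLipschitzOn {γ : ℝ → X} {F : ℝ → ℝ} {a b : ℝ}
    (hab : a ≤ b) (hγ : LocallyLipschitzOn (Icc a b) γ) (hF : LocallyLipschitzOn (Icc a b) F)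
    (h : ∀ᵐ t ∂volume.restrict (Ioo a b), DifferentiableAt ℝ F t ∧ 0 ≤ deriv F t ∧
      ∀ c > deriv F t, ∀ᶠ s in 𝓝 t, edist (γ t) (γ s) ≤ ENNReal.ofReal (c * |s - t|)) :
    F a ≤ F b ∧ edist (γ a) (γ b) ≤ ENNReal.ofReal (F b - F a) := by
  obtain ⟨L, hL⟩ := hF.exists_lipschitzOnWith_of_compact isCompact_Icc
  -- Besides being part of the claim, monotonicity makes increments nonnegative, so that
  -- `ENNReal.ofReal` is additive on them.
  have hmono : ∀ x ∈ Icc a b, ∀ y ∈ Icc a b, x ≤ y → F x ≤ F y := by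
    intro x hx y hy hxy
    have := le_of_lipschitzOnWith_of_ae_deriv_nonpos (G := fun t ↦ - F t) hxy
      (hL.mono (Icc_subset_Icc hx.1 hy.2)).neg ?_
    · linarith
    filter_upwards [ae_restrict_of_ae_restrict_of_subset (Ioo_subset_Ioo hx.1 hy.2) h]
      with t ht
    rw [deriv.fun_neg]
    linarith [ht.2.1]
  have ha : a ∈ Icc a b := left_mem_Icc.2 hab
  have hb : b ∈ Icc a b := right_mem_Icc.2 hab
  refine ⟨hmono a ha b hb hab, ?_⟩
  set S : Set ℝ := {t | edist (γ a) (γ t) ≤ ENNReal.ofReal (F t - F a)} with hS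
  suffices hsub : Icc a b ⊆ S from hsub hb
  refine IsClosed.Icc_subset_of_forall_mem_nhdsWithin ?_ (by simp [hS]) ?_
  · have := isClosed_Icc.isClosed_le (s := Icc a b) (f := fun t ↦ edist (γ a) (γ t))
      (g := fun t ↦ ENNReal.ofReal (F t - F a)) (continuous_edist.comp_continuousOn (continuousOn_const.prodMk hγ.continuousOn))
      (ENNReal.continuous_ofReal.comp_continuousOn (hF.continuousOn.sub continuousOn_const))
    rw [inter_comm]
    exact this
  · rintro x ⟨hxS, hx⟩
    have hx' : x ∈ Icc a b := ⟨hx.1, hx.2.le⟩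
    obtain ⟨K, u, hu, hK⟩ := hγ hx'
    have hu' : u ∈ 𝓝[≥] x := by
      rw [← nhdsWithin_Icc_eq_nhdsGE hx.2]
      exact nhdsWithin_mono _ (Icc_subset_Icc_left hx.1) hu
    obtain ⟨v, hxv, hv⟩ := (mem_nhdsGE_iff_exists_Icc_subset).1 hu'
    filter_upwards [Ioo_mem_nhdsGT (lt_min hxv hx.2)] with y hy
    have hyv : y ≤ v := hy.2.le.trans (min_le_left _ _)
    have hyb : y ≤ b := hy.2.le.trans (min_le_right _ _)
    have hy' : y ∈ Icc a b := ⟨hx.1.trans hy.1.le, hyb⟩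
    have h1 := edist_le_ofReal_sub_of_lipschitzOnWith hy.1.le
      (hK.mono ((Icc_subset_Icc_right hyv).trans hv)) (hL.mono (Icc_subset_Icc hx.1 hyb))
      (ae_restrict_of_ae_restrict_of_subset (Ioo_subset_Ioo hx.1 hyb) h)
    calc edist (γ a) (γ y) ≤ edist (γ a) (γ x) + edist (γ x) (γ y) := edist_triangle _ _ _
      _ ≤ ENNReal.ofReal (F x - F a) + ENNReal.ofReal (F y - F x) := add_le_add hxS h1
      _ = ENNReal.ofReal (F y - F a) := by
        rw [← ENNReal.ofReal_add (sub_nonneg.2 (hmono a ha x hx' hx.1))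
          (sub_nonneg.2 (hmono x hx' y hy' hy.1.le))]
        congr 1
        ring

end PseudoEMetric

/-! ### Riemannian distance read in charts -/

section Riemannian

variable {E : Type*} [NormedAddCommGroup E] [NormedSpace ℝ E]
  {H : Type*} [TopologicalSpace H] {I : ModelWithCorners ℝ E H}
  {M : Type*} [TopologicalSpace M] [ChartedSpace H M]
  [RiemannianBundle (fun (x : M) ↦ TangentSpace I x)]
  [IsManifold I 1 M] [IsContinuousRiemannianBundle E (fun (x : M) ↦ TangentSpace I x)]

/-- Continuity of the metric gives a distortion factor as close to 1 as desired. This precision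
matters: steepness has constant exactly 1, so an unspecified chart constant would spoil the speed
bound. -/
theorem eventually_enorm_symmL_le (x : M) {r : ℝ≥0} (hr : 1 < r) :
    ∀ᶠ y in 𝓝 x, ∀ u : E, ‖(trivializationAt E (TangentSpace I) x).symmL ℝ y u‖ₑ ≤
      r * ‖(trivializationAt E (TangentSpace I) x).symmL ℝ x u‖ₑ := by
  filter_upwards [eventually_norm_symmL_trivializationAt_comp_self_lt E
    (fun x : M ↦ TangentSpace I x) x (r := r) (by exact_mod_cast hr)] with y hy u
  have hx : x ∈ (trivializationAt E (TangentSpace I) x).baseSet :=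
    FiberBundle.mem_baseSet_trivializationAt' x
  have h1 := ContinuousLinearMap.le_of_opNorm_le _ hy.le
    ((trivializationAt E (TangentSpace I) x).symmL ℝ x u)
  rw [ContinuousLinearMap.comp_apply,
    Trivialization.continuousLinearMapAt_symmL _ hx] at h1
  rw [enorm_eq_nnnorm, enorm_eq_nnnorm]
  exact_mod_cast h1

theorem eventually_enorm_mfderivWithin_symm_extChartAt_comp_le (x : M) {r : ℝ≥0} (hr : 1 < r) :
    ∀ᶠ y in 𝓝 x, ∀ u : E,
      ‖mfderiv[range I] (extChartAt I x).symm (extChartAt I x y) u‖ₑ ≤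
        r * ‖(trivializationAt E (TangentSpace I) x).symmL ℝ x u‖ₑ := by
  filter_upwards [eventually_enorm_symmL_le (I := I) x hr, chart_source_mem_nhds H x]
    with y hy h'y u
  have hy := hy u
  rw [TangentBundle.symmL_trivializationAt h'y] at hy
  have A : (extChartAt I x).symm (extChartAt I x y) = y :=
    (extChartAt I x).left_inv (by simpa using h'y)
  rwa [A]

theorem eventually_enorm_mfderivWithin_symm_extChartAt_le (x : M) {r : ℝ≥0} (hr : 1 < r) :
    ∀ᶠ y in 𝓝[range I] (extChartAt I x x), ∀ u : E,
      ‖mfderiv[range I] (extChartAt I x).symm y u‖ₑ ≤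
        r * ‖(trivializationAt E (TangentSpace I) x).symmL ℝ x u‖ₑ := by
  have hA := eventually_enorm_mfderivWithin_symm_extChartAt_comp_le (I := I) x hr
  have h1 : Tendsto (extChartAt I x).symm (𝓝[range I] (extChartAt I x x)) (𝓝 x) := by
    have := continuousAt_extChartAt_symm (I := I) x
    rw [ContinuousAt, extChartAt_to_inv] at this
    exact this.mono_left nhdsWithin_le_nhds
  filter_upwards [h1.eventually hA, extChartAt_target_mem_nhdsWithin x] with y hy h'y u
  have hy := hy u
  rwa [(extChartAt I x).right_inv h'y] at hy

/-- Near `x`, the Riemannian distance to `x` is almost bounded by the norm of the displacement read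
in the chart at `x`. -/
theorem eventually_riemannianEDist_le_enorm_symmL (x : M) {r : ℝ≥0} (hr : 1 < r) :
    ∀ᶠ y in 𝓝 x, riemannianEDist I x y ≤
      r * ‖(trivializationAt E (TangentSpace I) x).symmL ℝ x
        (extChartAt I x y - extChartAt I x x)‖ₑ := by
  have hC := eventually_enorm_mfderivWithin_symm_extChartAt_le (I := I) x hr
  obtain ⟨ρ, ρ_pos, hρ⟩ := Metric.mem_nhdsWithin_iff.1
    (inter_mem (extChartAt_target_mem_nhdsWithin (I := I) x) hC)
  have A : (extChartAt I x) ⁻¹' (Metric.ball (extChartAt I x x) ρ ∩ range I) ∈ 𝓝 x := by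
    apply extChartAt_preimage_mem_nhds_of_mem_nhdsWithin (by simp)
    rw [inter_comm]
    exact inter_mem_nhdsWithin _ (Metric.ball_mem_nhds _ ρ_pos)
  filter_upwards [A, chart_source_mem_nhds H x] with y hy h'y
  -- The test path is the straight segment in the chart; by convexity it stays where the derivative
  -- bound holds.
  let η := ContinuousAffineMap.lineMap (R := ℝ) (extChartAt I x x) (extChartAt I x y)
  set γ := (extChartAt I x).symm ∘ η
  have hη : Icc 0 1 ⊆ ⇑η ⁻¹' ((extChartAt I x).target ∩
      {y | ∀ u : E, ‖mfderiv[range I] (extChartAt I x).symm y u‖ₑ ≤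
        r * ‖(trivializationAt E (TangentSpace I) x).symmL ℝ x u‖ₑ}) := by
    rw [← image_subset_iff]
    simp only [ContinuousAffineMap.coe_lineMap_eq, ← segment_eq_image_lineMap, η]
    exact (((convex_ball _ _).inter I.convex_range).segment_subset
      (by simp [ρ_pos]) hy).trans hρ
  simp only [preimage_inter, subset_inter_iff] at hη
  have η_smooth : ContMDiffOn 𝓘(ℝ, ℝ) 𝓘(ℝ, E) 1 η (Icc 0 1) := by
    apply ContMDiff.contMDiffOn
    rw [contMDiff_iff_contDiff]
    exact ContinuousAffineMap.contDiff _
  have hle : riemannianEDist I x y ≤ pathELength I γ 0 1 := by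
    apply riemannianEDist_le_pathELength _ _ _ zero_le_one
    · exact (contMDiffOn_extChartAt_symm x).comp η_smooth hη.1
    · simp [γ, η, ContinuousAffineMap.coe_lineMap_eq]
    · simp [γ, η, ContinuousAffineMap.coe_lineMap_eq, h'y]
  refine hle.trans ?_
  rw [pathELength_eq_lintegral_mfderivWithin_Icc]
  have hbound : ∀ t ∈ Icc (0 : ℝ) 1, ‖mfderiv[Icc 0 1] γ t 1‖ₑ ≤
      r * ‖(trivializationAt E (TangentSpace I) x).symmL ℝ x
        (extChartAt I x y - extChartAt I x x)‖ₑ := by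
    intro t ht
    have h1 : mfderiv[Icc 0 1] γ t =
        (mfderiv[range I] (extChartAt I x).symm (η t)) ∘L (mfderiv[Icc 0 1] η t) := by
      apply mfderivWithin_comp
      · exact mdifferentiableWithinAt_extChartAt_symm (hη.1 ht)
      · exact η_smooth.mdifferentiableOn one_ne_zero t ht
      · exact hη.1.trans (preimage_mono (extChartAt_target_subset_range x))
      · rw [uniqueMDiffWithinAt_iff_uniqueDiffWithinAt]
        exact uniqueDiffOn_Icc zero_lt_one t ht
    have h2 : mfderiv[Icc 0 1] η t (1 : ℝ) = extChartAt I x y - extChartAt I x x := by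
      have h := (AffineMap.hasDerivAt_lineMap (a := extChartAt I x x) (b := extChartAt I x y)
        (x := t)).hasDerivWithinAt (s := Icc 0 1)
      rw [mfderivWithin_eq_fderivWithin]
      have h4 : fderivWithin ℝ η (Icc 0 1) t = _ :=
        h.hasFDerivWithinAt.fderivWithin (uniqueDiffOn_Icc zero_lt_one t ht)
      rw [h4]
      exact one_smul ℝ _
    have h3 : mfderiv[Icc 0 1] γ t (1 : ℝ) =
        (mfderiv[range I] (extChartAt I x).symm (η t)) (mfderiv[Icc 0 1] η t (1 : ℝ)) :=
      congr($h1 (1 : ℝ))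
    exact (congrArg (fun w : TangentSpace I (γ t) ↦ ‖w‖ₑ) (h3.trans (congrArg _ h2))).trans_le
      (hη.2 ht _)
  refine (setLIntegral_mono' measurableSet_Icc hbound).trans ?_
  simp

omit [RiemannianBundle (fun (x : M) ↦ TangentSpace I x)]
  [IsContinuousRiemannianBundle E (fun (x : M) ↦ TangentSpace I x)] in
-- The tangent space at `x` is `E` seen through the preferred chart at `x`. Writing `symmL`
-- explicitly marks the passage to the Riemannian norm on the fibre.
theorem symmL_trivializationAt_self_apply (x : M) (u : E) :
    (trivializationAt E (TangentSpace I) x).symmL ℝ x u = u := by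
  rw [TangentBundle.symmL_trivializationAt_eq_core (mem_chart_source H x)]
  exact (tangentBundleCore I M).coordChange_self (achart H x) x (mem_chart_source H x) u

theorem eventually_norm_map_sub_le {F G : Type*} [NormedAddCommGroup F] [NormedSpace ℝ F]
    [NormedAddCommGroup G] [NormedSpace ℝ G] (L : F →L[ℝ] G) {u : ℝ → F} {v : F} {t c : ℝ}
    (hu : HasDerivAt u v t) (hc : ‖L v‖ < c) :
    ∀ᶠ s in 𝓝 t, ‖L (u s - u t)‖ ≤ c * |s - t| := by
  have hLu : HasDerivAt (fun s ↦ L (u s)) (L v) t := L.hasFDerivAt.comp_hasDerivAt t hu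
  filter_upwards [hLu.isLittleO.bound (sub_pos.2 hc)] with s hs
  have h2 : L (u s - u t) = (L (u s) - L (u t) - (s - t) • L v) + (s - t) • L v := by
    rw [map_sub]
    abel
  rw [h2]
  refine (norm_add_le _ _).trans ?_
  rw [norm_smul]
  rw [Real.norm_eq_abs] at hs ⊢
  nlinarith

omit [RiemannianBundle (fun (x : M) ↦ TangentSpace I x)]
  [IsContinuousRiemannianBundle E (fun (x : M) ↦ TangentSpace I x)] [IsManifold I 1 M] in
theorem hasDerivAt_extChartAt_comp {γ : ℝ → M} {t : ℝ}
    (hγ : MDifferentiableAt 𝓘(ℝ, ℝ) I γ t) :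
    HasDerivAt (fun s ↦ extChartAt I (γ t) (γ s)) (mfderiv 𝓘(ℝ, ℝ) I γ t (1 : ℝ) : E) t := by
  have h1 := hγ.hasMFDerivAt.2
  simp only [writtenInExtChartAt, extChartAt_model_space_eq_id, modelWithCornersSelf_coe,
    range_id, PartialEquiv.refl_coe, PartialEquiv.refl_symm, id,
    Function.comp_def] at h1
  -- Stated for plain linear maps, so that the tangent spaces in `h1` are unfolded by unification.
  have key : ∀ (A : ℝ →L[ℝ] E) (u : ℝ → E), HasFDerivWithinAt u A univ t →
      HasDerivAt u (A 1) t := fun A u h ↦ (hasFDerivWithinAt_univ.1 h).hasDerivAt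
  exact key _ _ h1

/-- At a point of differentiability, the metric speed of a curve is at most the norm of its
velocity. -/
theorem eventually_riemannianEDist_le_of_mdifferentiableAt {γ : ℝ → M} {t : ℝ}
    (hγ : MDifferentiableAt 𝓘(ℝ, ℝ) I γ t) {c : ℝ}
    (hc : ‖(mfderiv 𝓘(ℝ, ℝ) I γ t (1 : ℝ) : TangentSpace I (γ t))‖ < c) :
    ∀ᶠ s in 𝓝 t, riemannianEDist I (γ t) (γ s) ≤ ENNReal.ofReal (c * |s - t|) := by
  -- The room below `c` is shared: `c'` absorbs the error of the difference quotient, and `c / c'`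
  -- the distortion of the metric.
  obtain ⟨c', hvc', hc'⟩ := exists_between hc
  have hc'0 : 0 < c' := (norm_nonneg _).trans_lt hvc'
  rw [← symmL_trivializationAt_self_apply (I := I) (γ t) (mfderiv 𝓘(ℝ, ℝ) I γ t (1 : ℝ))] at hvc'
  have hslope := eventually_norm_map_sub_le
    ((trivializationAt E (TangentSpace I) (γ t)).symmL ℝ (γ t))
    (hasDerivAt_extChartAt_comp hγ) hvc'
  have hr : (1 : ℝ) < c / c' := (one_lt_div hc'0).2 hc'
  have hr' : 1 < (c / c').toNNReal := by simpa using hr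
  have h3 := hγ.continuousAt.eventually
    (eventually_riemannianEDist_le_enorm_symmL (I := I) (γ t) hr')
  filter_upwards [hslope, h3] with s hs h3
  refine h3.trans ?_
  rw [← ofReal_norm, ← ENNReal.ofReal, ← ENNReal.ofReal_mul (by positivity)]
  refine ENNReal.ofReal_le_ofReal ?_
  refine (mul_le_mul_of_nonneg_left hs (by positivity)).trans_eq ?_
  field_simp

attribute [local instance] normedAddCommGroupTangentSpaceVectorSpace
  normedSpaceTangentSpaceVectorSpace

theorem eventually_enorm_mfderiv_extChartAt_apply_le (x : M) :
    ∃ C > (0 : ℝ≥0), ∀ᶠ y in 𝓝 x, ∀ v : TangentSpace I y,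
      ‖(mfderiv I 𝓘(ℝ, E) (extChartAt I x) y v : E)‖ₑ ≤ C * ‖v‖ₑ := by
  obtain ⟨C, C_pos, hC⟩ := eventually_enorm_mfderiv_extChartAt_lt I x
  refine ⟨C, C_pos, hC.mono fun y hy v ↦ ?_⟩
  exact (ContinuousLinearMap.le_opENorm _ v).trans (mul_le_mul_left hy.le _)

/-- Charts are locally Lipschitz for the Riemannian distance. -/
theorem exists_edist_extChartAt_le_riemannianEDist [RegularSpace M] (x : M) :
    ∃ C : ℝ≥0, ∃ u ∈ 𝓝 x, ∀ y ∈ u, ∀ z ∈ u,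
      edist (extChartAt I x y) (extChartAt I x z) ≤ C * riemannianEDist I y z := by
  obtain ⟨C, C_pos, hC⟩ := eventually_enorm_mfderiv_extChartAt_apply_le (I := I) x
  obtain ⟨ρ, ρ_pos, hρ⟩ := setOfPred_riemannianEDist_lt_subset_nhds I
    (inter_mem hC (chart_source_mem_nhds H x))
  have hρ4 : (0 : ℝ≥0∞) < (ρ / 4 : ℝ≥0) := by
    have : 0 < ρ / 4 := by positivity
    exact_mod_cast this
  -- A path of length below ρ/2 starting within ρ/4 of `x` stays within `ρ`, where the derivative of
  -- the chart is bounded by `C`.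
  refine ⟨C, {y | riemannianEDist I x y < (ρ / 4 : ℝ≥0)}, eventually_riemannianEDist_lt I x hρ4,
    fun y hy z hz ↦ ?_⟩
  have hyz : riemannianEDist I y z < (ρ / 2 : ℝ≥0) := by
    calc riemannianEDist I y z ≤ riemannianEDist I y x + riemannianEDist I x z :=
          riemannianEDist_triangle
      _ < (ρ / 4 : ℝ≥0) + (ρ / 4 : ℝ≥0) := by
          rw [riemannianEDist_comm (x := y)]
          exact ENNReal.add_lt_add hy hz
      _ = (ρ / 2 : ℝ≥0) := by
          rw [← ENNReal.coe_add]
          congr 1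
          field_simp
          norm_num
  by_contra! hlt
  have hC0 : (C : ℝ≥0∞) ≠ 0 := by exact_mod_cast C_pos.ne'
  rw [mul_comm, ← ENNReal.lt_div_iff_mul_lt (Or.inl hC0) (Or.inl ENNReal.coe_ne_top)] at hlt
  -- A path shorter than `r` is short enough both to stay in the good region and to contradict the
  -- bound it satisfies there.
  obtain ⟨r, hyr, hr⟩ := exists_between (lt_min hlt hyz)
  obtain ⟨γ, hγy, hγz, γ_smooth, hγ⟩ := exists_lt_of_riemannianEDist_lt hyr
  have hmem : ∀ t ∈ Icc (0 : ℝ) 1, γ t ∈ {y | ∀ v : TangentSpace I y,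
      ‖(mfderiv I 𝓘(ℝ, E) (extChartAt I x) y v : E)‖ₑ ≤ C * ‖v‖ₑ} ∩
      (chartAt H x).source := by
    intro t ht
    apply hρ
    have h1 : riemannianEDist I y (γ t) < (ρ / 2 : ℝ≥0) := by
      refine lt_of_le_of_lt ?_ (hγ.trans (hr.trans_le (min_le_right _ _)))
      exact (riemannianEDist_le_pathELength
        (γ_smooth.mono (Icc_subset_Icc_right ht.2)) hγy rfl ht.1).trans
        (pathELength_mono le_rfl ht.2)
    calc riemannianEDist I x (γ t) ≤ riemannianEDist I x y + riemannianEDist I y (γ t) :=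
          riemannianEDist_triangle
      _ < (ρ / 4 : ℝ≥0) + (ρ / 2 : ℝ≥0) := ENNReal.add_lt_add hy h1
      _ ≤ ρ := by
          rw [← ENNReal.coe_add, ENNReal.coe_le_coe, ← NNReal.coe_le_coe]
          push_cast
          have := ρ.coe_nonneg
          linarith
  have hsmooth : ContMDiffOn 𝓘(ℝ, ℝ) 𝓘(ℝ, E) 1 (extChartAt I x ∘ γ) (Icc 0 1) :=
    contMDiffOn_extChartAt.comp (I' := I) (t := (chartAt H x).source) γ_smooth
      (fun t ht ↦ (hmem t ht).2)
  have hle : edist (extChartAt I x y) (extChartAt I x z) ≤ C * pathELength I γ 0 1 := by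
    rw [edist_comm, edist_eq_enorm_sub, ← hγy, ← hγz]
    calc ‖(extChartAt I x ∘ γ) 1 - (extChartAt I x ∘ γ) 0‖ₑ
      _ ≤ ∫⁻ t in Icc 0 1, ‖derivWithin (extChartAt I x ∘ γ) (Icc 0 1) t‖ₑ := by
        apply enorm_sub_le_lintegral_derivWithin_Icc_of_contDiffOn_Icc _ zero_le_one
        rwa [← contMDiffOn_iff_contDiffOn]
      _ = ∫⁻ t in Icc 0 1, ‖mfderiv[Icc 0 1] (extChartAt I x ∘ γ) t 1‖ₑ := by
        simp_rw [← fderivWithin_derivWithin, mfderivWithin_eq_fderivWithin]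
        rfl
      _ ≤ ∫⁻ t in Icc 0 1, C * ‖mfderiv[Icc 0 1] γ t 1‖ₑ := by
        apply setLIntegral_mono' measurableSet_Icc (fun t ht ↦ ?_)
        have h1 : mfderiv[Icc 0 1] (extChartAt I x ∘ γ) t =
            (mfderiv% (extChartAt I x) (γ t)) ∘L (mfderiv[Icc 0 1] γ t) := by
          apply mfderiv_comp_mfderivWithin
          · exact mdifferentiableAt_extChartAt (hmem t ht).2
          · exact γ_smooth.mdifferentiableOn one_ne_zero _ ht
          · rw [uniqueMDiffWithinAt_iff_uniqueDiffWithinAt]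
            exact uniqueDiffOn_Icc zero_lt_one _ ht
        have h2 : mfderiv[Icc 0 1] (extChartAt I x ∘ γ) t 1 =
            (mfderiv% (extChartAt I x) (γ t)) (mfderiv[Icc 0 1] γ t 1) :=
          congr($h1 1)
        exact (congrArg (fun w : E ↦ ‖w‖ₑ) h2).trans_le ((hmem t ht).1 _)
      _ = C * pathELength I γ 0 1 := by
        rw [lintegral_const_mul' _ _ ENNReal.coe_ne_top,
          pathELength_eq_lintegral_mfderivWithin_Icc]
  have hr1 : r * C < edist (extChartAt I x y) (extChartAt I x z) :=
    (ENNReal.lt_div_iff_mul_lt (Or.inl hC0) (Or.inl ENNReal.coe_ne_top)).1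
      (hr.trans_le (min_le_left _ _))
  refine absurd hle (not_le.2 ((mul_le_mul_right hγ.le _).trans_lt ?_))
  rwa [mul_comm]

/-- A `C^1` map to a normed space is locally Lipschitz for the Riemannian distance. -/
theorem exists_edist_le_riemannianEDist_of_contMDiff [RegularSpace M] {F : Type*}
    [NormedAddCommGroup F] [NormedSpace ℝ F] {f : M → F} (hf : ContMDiff I 𝓘(ℝ, F) 1 f) (x : M) :
    ∃ C : ℝ≥0, ∃ u ∈ 𝓝 x, ∀ y ∈ u, ∀ z ∈ u, edist (f y) (f z) ≤ C * riemannianEDist I y z := by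
  obtain ⟨C, u, hu, hC⟩ := exists_edist_extChartAt_le_riemannianEDist (I := I) x
  have h1 : ContDiffWithinAt ℝ 1 (f ∘ (extChartAt I x).symm) (range I) (extChartAt I x x) := by
    have := (contMDiffAt_iff.1 (hf x)).2
    simp only [extChartAt_model_space_eq_id, PartialEquiv.refl_coe, Function.id_comp] at this
    exact this
  obtain ⟨K, t, ht, hK⟩ := h1.exists_lipschitzOnWith I.convex_range
  have h2 : (extChartAt I x) ⁻¹' t ∈ 𝓝 x :=
    extChartAt_preimage_mem_nhds_of_mem_nhdsWithin (by simp) ht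
  refine ⟨K * C, (u ∩ (extChartAt I x) ⁻¹' t) ∩ (extChartAt I x).source,
    inter_mem (inter_mem hu h2) (extChartAt_source_mem_nhds x), fun y hy z hz ↦ ?_⟩
  have h3 := hK hy.1.2 hz.1.2
  simp only [Function.comp_apply, (extChartAt I x).left_inv hy.2,
    (extChartAt I x).left_inv hz.2] at h3
  refine h3.trans ?_
  rw [ENNReal.coe_mul, mul_assoc]
  gcongr
  exact hC y hy.1.1 z hz.1.1

end Riemannian
-- Growth of a steep function controls Riemannian distance
section Steep

variable {d : ℕ} {M : Type*} [TopologicalSpace M] [ChartedSpace (Model d) M]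
  [IsManifold (𝓡 d) ∞ M] [T2Space M]

theorem eventually_riemDist_le_of_mdifferentiableAt (h : RiemMetric d M) {γ : ℝ → M} {t c : ℝ}
    (hγ : MDifferentiableAt 𝓘(ℝ, ℝ) (𝓡 d) γ t)
    (hc : riemNorm h (Spacetime.velocity γ t) < c) :
    ∀ᶠ s in 𝓝 t, (riemDist h).edist (γ t) (γ s) ≤ ENNReal.ofReal (c * |s - t|) := by
  let : RiemannianBundle (fun x : M ↦ TangentSpace (𝓡 d) x) := ⟨h.toRiemannianMetric⟩
  have : IsManifold (𝓡 d) 1 M := IsManifold.of_le (n := ∞) (by simp)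
  have : IsContinuousRiemannianBundle (Model d) (fun x : M ↦ TangentSpace (𝓡 d) x) :=
    ⟨⟨h.inner, h.contMDiff.continuous, fun _ _ _ ↦ rfl⟩⟩
  -- With these instances `riemNorm h` and the distance of `riemDist h` agree by definition with the
  -- bundle norm and `riemannianEDist`.
  exact eventually_riemannianEDist_le_of_mdifferentiableAt hγ hc

theorem exists_edist_le_riemDist (h : RiemMetric d M) {τ : M → ℝ}
    (hτ : ContMDiff (𝓡 d) 𝓘(ℝ, ℝ) ∞ τ) (x : M) :
    ∃ C : ℝ≥0, ∃ u ∈ 𝓝 x, ∀ y ∈ u, ∀ z ∈ u, edist (τ y) (τ z) ≤ C * (riemDist h).edist y z := by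
  let : RiemannianBundle (fun x : M ↦ TangentSpace (𝓡 d) x) := ⟨h.toRiemannianMetric⟩
  have : LocallyCompactSpace M := Manifold.locallyCompact_of_finiteDimensional (𝓡 d)
  have : IsManifold (𝓡 d) 1 M := IsManifold.of_le (n := ∞) (by simp)
  have : IsContinuousRiemannianBundle (Model d) (fun x : M ↦ TangentSpace (𝓡 d) x) :=
    ⟨⟨h.inner, h.contMDiff.continuous, fun _ _ _ ↦ rfl⟩⟩
  exact exists_edist_le_riemannianEDist_of_contMDiff (hτ.of_le (by simp)) x

theorem locallyLipschitzOn_comp_of_contMDiff (h : RiemMetric d M) {τ : M → ℝ}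
    (hτ : ContMDiff (𝓡 d) 𝓘(ℝ, ℝ) ∞ τ) {γ : ℝ → M} {s : Set ℝ}
    (hγ : Spacetime.IsLocLipschitzCurve d γ s) : LocallyLipschitzOn s (fun t ↦ τ (γ t)) := by
  let : EMetricSpace M := riemDist h
  intro t ht
  have hγ' : LocallyLipschitzOn s γ := hγ h
  obtain ⟨K, v, hv, hK⟩ := hγ' ht
  obtain ⟨C, u, hu, hC⟩ := exists_edist_le_riemDist h hτ (γ t)
  refine ⟨C * K, v ∩ γ ⁻¹' u, inter_mem hv (hγ'.continuousOn t ht hu), fun y hy z hz ↦ ?_⟩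
  refine (hC _ hy.2 _ hz.2).trans ?_
  rw [ENNReal.coe_mul, mul_assoc]
  gcongr
  exact hK hy.1 hz.1

/-- Along a curve whose speed is bounded by the rate of growth of `τ`, the increments of `τ` bound
the Riemannian distance. -/
theorem riemDist_le_of_riemNorm_le_diff (h : RiemMetric d M) {τ : M → ℝ}
    (hτ : ContMDiff (𝓡 d) 𝓘(ℝ, ℝ) ∞ τ) {γ : ℝ → M} {s : Set ℝ}
    (hγ : Spacetime.IsLocLipschitzCurve d γ s)
    (hv : ∀ᵐ t ∂volume.restrict s, MDifferentiableAt 𝓘(ℝ, ℝ) (𝓡 d) γ t ∧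
      riemNorm h (Spacetime.velocity (d := d) γ t) ≤ Spacetime.diff τ (Spacetime.velocity (d := d) γ t))
    {a b : ℝ} (hab : a ≤ b) (hs : Icc a b ⊆ s) :
    τ (γ a) ≤ τ (γ b) ∧
      (riemDist h).edist (γ a) (γ b) ≤ ENNReal.ofReal (τ (γ b) - τ (γ a)) := by
  let : EMetricSpace M := riemDist h
  have hγ' : LocallyLipschitzOn s γ := hγ h
  refine edist_le_ofReal_sub_of_locallyLipschitzOn (F := fun t ↦ τ (γ t)) hab (hγ'.mono hs)
    ((locallyLipschitzOn_comp_of_contMDiff h hτ hγ).mono hs) ?_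
  filter_upwards [ae_restrict_of_ae_restrict_of_subset (Ioo_subset_Icc_self.trans hs) hv]
    with t ⟨hdiff, hle⟩
  have hτt : MDifferentiableAt (𝓡 d) 𝓘(ℝ, ℝ) τ (γ t) := hτ.mdifferentiable (by simp) _
  have hder : HasDerivAt (fun t ↦ τ (γ t)) (Spacetime.diff τ (Spacetime.velocity (d := d) γ t)) t := by
    have h1 := (hτt.hasMFDerivAt.comp t hdiff.hasMFDerivAt).hasFDerivAt
    have key : ∀ (A : ℝ →L[ℝ] ℝ) (u : ℝ → ℝ), HasFDerivAt u A t → HasDerivAt u (A 1) t :=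
      fun A u hu ↦ hu.hasDerivAt
    exact key _ _ h1
  rw [hder.deriv]
  refine ⟨hder.differentiableAt, (Real.sqrt_nonneg _).trans hle, fun c hc ↦ ?_⟩
  exact eventually_riemDist_le_of_mdifferentiableAt h hdiff (hle.trans_lt hc)

/-! ### Inextendible curves and level sets -/

/-- If the increments of `τ` along a curve in a complete manifold bound the Riemannian distance and
the curve has no future endpoint, then `τ` is unbounded above along it. -/
theorem exists_lt_of_not_tendsto_atTop (h : RiemMetric d M) (hcomp : IsCompleteMetric h)
    {τ : M → ℝ} {γ : ℝ → M} {s : Set ℝ} (hne : s.Nonempty)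
    (hmono : ∀ a ∈ s, ∀ b ∈ s, a ≤ b → τ (γ a) ≤ τ (γ b) ∧
      (riemDist h).edist (γ a) (γ b) ≤ ENNReal.ofReal (τ (γ b) - τ (γ a)))
    (hlim : ¬ ∃ p : M, Tendsto (fun t : s ↦ γ t) atTop (𝓝 p)) (c : ℝ) :
    ∃ t ∈ s, c < τ (γ t) := by
  by_contra! hbd
  apply hlim
  let : EMetricSpace M := riemDist h
  have : CompleteSpace M := hcomp
  have : Nonempty s := hne.to_subtype
  suffices hC : Cauchy (map (fun t : s ↦ γ t) atTop) from CompleteSpace.complete hC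
  set f : s → ℝ := fun t ↦ τ (γ t) with hf
  have hfmono : Monotone f := fun x y hxy ↦ (hmono x x.2 y y.2 hxy).1
  have hfbdd : BddAbove (range f) := ⟨c, by rintro _ ⟨t, rfl⟩; exact hbd t t.2⟩
  rw [EMetric.cauchy_iff]
  refine ⟨NeBot.ne inferInstance, fun ε hε ↦ ?_⟩
  -- A real `δ` is needed since `ε` may be infinite. Once `τ ∘ γ` is within `δ` of its supremum, its
  -- later increments, hence distances, are at most `δ`.
  obtain ⟨δ, hδ0, hδ⟩ : ∃ δ : ℝ, 0 < δ ∧ ENNReal.ofReal δ < ε := by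
    obtain ⟨δ, hδ0, hδ⟩ := ENNReal.lt_iff_exists_nnreal_btwn.1 hε
    exact ⟨δ, by exact_mod_cast hδ0, by simpa using hδ⟩
  have hev : ∀ᶠ t in atTop, (⨆ t, f t) - δ < f t :=
    (tendsto_atTop_ciSup hfmono hfbdd).eventually (lt_mem_nhds (sub_lt_self _ hδ0))
  refine ⟨_, image_mem_map hev, ?_⟩
  have hlt : ∀ x y : s, x ≤ y → (⨆ t, f t) - δ < f x → edist (γ x) (γ y) < ε := by
    intro x y hxy hx
    refine ((hmono x x.2 y y.2 hxy).2.trans (ENNReal.ofReal_le_ofReal ?_)).trans_lt hδ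
    have := le_ciSup hfbdd y
    change f y - f x ≤ δ
    linarith
  rintro _ ⟨x, hx, rfl⟩ _ ⟨y, hy, rfl⟩
  rcases le_total x y with hxy | hxy
  · exact hlt x y hxy hx
  · rw [edist_comm]
    exact hlt y x hxy hy

/-- The same as `exists_lt_of_not_tendsto_atTop`, at the other end of the curve. -/
theorem exists_gt_of_not_tendsto_atBot (h : RiemMetric d M) (hcomp : IsCompleteMetric h)
    {τ : M → ℝ} {γ : ℝ → M} {s : Set ℝ} (hne : s.Nonempty)
    (hmono : ∀ a ∈ s, ∀ b ∈ s, a ≤ b → τ (γ a) ≤ τ (γ b) ∧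
      (riemDist h).edist (γ a) (γ b) ≤ ENNReal.ofReal (τ (γ b) - τ (γ a)))
    (hlim : ¬ ∃ p : M, Tendsto (fun t : s ↦ γ t) atBot (𝓝 p)) (c : ℝ) :
    ∃ t ∈ s, τ (γ t) < c := by
  by_contra! hbd
  apply hlim
  let : EMetricSpace M := riemDist h
  have : CompleteSpace M := hcomp
  have : Nonempty s := hne.to_subtype
  suffices hC : Cauchy (map (fun t : s ↦ γ t) atBot) from CompleteSpace.complete hC
  set f : s → ℝ := fun t ↦ τ (γ t) with hf
  have hfmono : Monotone f := fun x y hxy ↦ (hmono x x.2 y y.2 hxy).1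
  have hfbdd : BddBelow (range f) := ⟨c, by rintro _ ⟨t, rfl⟩; exact hbd t t.2⟩
  rw [EMetric.cauchy_iff]
  refine ⟨NeBot.ne inferInstance, fun ε hε ↦ ?_⟩
  obtain ⟨δ, hδ0, hδ⟩ : ∃ δ : ℝ, 0 < δ ∧ ENNReal.ofReal δ < ε := by
    obtain ⟨δ, hδ0, hδ⟩ := ENNReal.lt_iff_exists_nnreal_btwn.1 hε
    exact ⟨δ, by exact_mod_cast hδ0, by simpa using hδ⟩
  have hev : ∀ᶠ t in atBot, f t < (⨅ t, f t) + δ :=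
    (tendsto_atBot_ciInf hfmono hfbdd).eventually (gt_mem_nhds (lt_add_of_pos_right _ hδ0))
  refine ⟨_, image_mem_map hev, ?_⟩
  have hlt : ∀ x y : s, x ≤ y → f y < (⨅ t, f t) + δ → edist (γ x) (γ y) < ε := by
    intro x y hxy hy
    refine ((hmono x x.2 y y.2 hxy).2.trans (ENNReal.ofReal_le_ofReal ?_)).trans_lt hδ
    have := ciInf_le hfbdd x
    change f y - f x ≤ δ
    linarith
  rintro _ ⟨x, hx, rfl⟩ _ ⟨y, hy, rfl⟩
  rcases le_total x y with hxy | hxy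
  · exact hlt x y hxy hy
  · rw [edist_comm]
    exact hlt y x hxy hx

/-- An inextendible curve with nonvanishing velocity whose speed is bounded by the rate of growth
of `τ` meets every level set of `τ` exactly once. -/
theorem existsUnique_level_of_riemNorm_le_diff (h : RiemMetric d M) (hcomp : IsCompleteMetric h)
    {τ : M → ℝ} (hτ : ContMDiff (𝓡 d) 𝓘(ℝ, ℝ) ∞ τ) {γ : ℝ → M} {s : Set ℝ} (hne : s.Nonempty)
    (hs : s.OrdConnected) (hγ : Spacetime.IsLocLipschitzCurve d γ s)
    (hv : ∀ᵐ t ∂volume.restrict s, MDifferentiableAt 𝓘(ℝ, ℝ) (𝓡 d) γ t ∧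
      riemNorm h (Spacetime.velocity (d := d) γ t) ≤ Spacetime.diff τ (Spacetime.velocity (d := d) γ t))
    (hv0 : ∀ᵐ t ∂volume.restrict s, Spacetime.velocity (d := d) γ t ≠ 0)
    (htop : ¬ ∃ p : M, Tendsto (fun t : s ↦ γ t) atTop (𝓝 p))
    (hbot : ¬ ∃ p : M, Tendsto (fun t : s ↦ γ t) atBot (𝓝 p)) (c : ℝ) :
    ∃! t : ℝ, t ∈ s ∧ τ (γ t) = c := by
  have hmono : ∀ a ∈ s, ∀ b ∈ s, a ≤ b → τ (γ a) ≤ τ (γ b) ∧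
      (riemDist h).edist (γ a) (γ b) ≤ ENNReal.ofReal (τ (γ b) - τ (γ a)) :=
    fun a ha b hb hab ↦ riemDist_le_of_riemNorm_le_diff h hτ hγ hv hab (hs.out ha hb)
  have hinj : ∀ a ∈ s, ∀ b ∈ s, a < b → τ (γ a) ≠ τ (γ b) := by
    intro a ha b hb hab heq
    have hsub := hs.out ha hb
    -- By monotonicity every increment of `τ ∘ γ` between `a` and `b` vanishes, and with it the
    -- distance.
    have hconst : ∀ t ∈ Icc a b, γ t = γ a := by
      intro t ht
      have h1 := hmono a ha t (hsub ht) ht.1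
      have h2 := hmono t (hsub ht) b hb ht.2
      let : EMetricSpace M := riemDist h
      have h3 : edist (γ a) (γ t) ≤ 0 := by
        refine h1.2.trans ?_
        rw [nonpos_iff_eq_zero, ENNReal.ofReal_eq_zero]
        linarith [h2.1]
      exact (edist_le_zero.1 h3).symm
    have hae := ae_restrict_of_ae_restrict_of_subset (Ioo_subset_Icc_self.trans hsub) hv0
    -- Constancy forces zero velocity throughout the open interval, which must then be null, against
    -- `a < b`.
    have hfalse : ∀ᵐ t ∂volume.restrict (Ioo a b), False := by
      filter_upwards [hae, ae_restrict_mem measurableSet_Ioo] with t ht htI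
      apply ht
      have h1 : γ =ᶠ[𝓝 t] fun _ ↦ γ a := by
        filter_upwards [Icc_mem_nhds htI.1 htI.2] with r hr using hconst r hr
      have h2 : mfderiv 𝓘(ℝ, ℝ) (𝓡 d) γ t = 0 := by
        rw [h1.mfderiv_eq]
        exact mfderiv_const
      rw [Spacetime.velocity, h2]
      rfl
    rw [ae_iff] at hfalse
    simp at hfalse
    exact absurd hab (not_lt.2 hfalse)
  obtain ⟨t₁, ht₁, hc₁⟩ := exists_gt_of_not_tendsto_atBot h hcomp hne hmono hbot c
  obtain ⟨t₂, ht₂, hc₂⟩ := exists_lt_of_not_tendsto_atTop h hcomp hne hmono htop c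
  obtain ⟨t, ht, htc⟩ := hs.isPreconnected.intermediate_value ht₁ ht₂
    (locallyLipschitzOn_comp_of_contMDiff h hτ hγ).continuousOn ⟨hc₁.le, hc₂.le⟩
  refine ⟨t, ⟨ht, htc⟩, fun r hr ↦ ?_⟩
  rcases lt_trichotomy r t with hrt | hrt | hrt
  · exact absurd (hr.2.trans htc.symm) (hinj r hr.1 t ht hrt)
  · exact hrt
  · exact absurd (htc.trans hr.2.symm) (hinj t ht r hr.1 hrt)

/-! ### Sign changes for past-directed curves -/

namespace Spacetime

variable (g : Spacetime d M)

omit [T2Space M] in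
theorem IsPastCausal.neg {g : Spacetime d M} {p : M} {v : TangentSpace (𝓡 d) p}
    (hv : g.IsPastCausal v) : g.IsFutureCausal (-v) := by
  obtain ⟨⟨h1, h2⟩, h3⟩ := hv
  exact ⟨⟨by simpa using h1, neg_ne_zero.2 h2⟩, by simpa using h3⟩

omit [T2Space M] in
theorem riemNorm_neg (h : RiemMetric d M) {p : M} (v : TangentSpace (𝓡 d) p) :
    riemNorm h (-v) = riemNorm h v := by
  simp [riemNorm]

omit [T2Space M] [IsManifold (𝓡 d) ∞ M] in
theorem diff_neg_left (τ : M → ℝ) {p : M} (v : TangentSpace (𝓡 d) p) :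
    diff (fun x ↦ - τ x) v = diff τ (-v) := by
  have h1 : mfderiv (𝓡 d) 𝓘(ℝ, ℝ) (fun x ↦ - τ x) p = - mfderiv (𝓡 d) 𝓘(ℝ, ℝ) τ p :=
    mfderiv_neg
  rw [diff, diff, map_neg, h1]
  rfl

end Spacetime

end Steep

end NullDist

/-! ### The Cauchy property -/

theorem mainTheorem7 {d : ℕ} {M : Type*} [TopologicalSpace M] [T2Space M]
    [ChartedSpace (NullDist.Model d) M] [IsManifold (𝓡 d) ∞ M]
    (g : NullDist.Spacetime d M) (h : NullDist.RiemMetric d M)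
    (h_complete : NullDist.IsCompleteMetric h)
    (τ : M → ℝ) (hτ : g.IsTemporal τ) (h_steep : g.IsSteep h τ) :
    g.IsCauchyTimeFunction τ := by
  refine ⟨⟨hτ.1.continuous, ?_⟩, ?_⟩
  · rintro p q ⟨rfl | ⟨a, b, γ, hab, ⟨hγ, hv⟩, rfl, rfl⟩, hne⟩
    · exact absurd rfl hne
    have h1 := NullDist.riemDist_le_of_riemNorm_le_diff h hτ.1 hγ
      (hv.mono fun t ht ↦ ⟨ht.1, h_steep _ _ ht.2⟩) hab.le subset_rfl
    -- If `τ` did not increase, the estimate would put the endpoints at distance zero.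
    by_contra! hle
    let : EMetricSpace M := NullDist.riemDist h
    have h2 : edist (γ a) (γ b) ≤ 0 := by
      refine h1.2.trans ?_
      rw [nonpos_iff_eq_zero, ENNReal.ofReal_eq_zero]
      linarith
    exact hne (edist_le_zero.1 h2).symm
  · rintro γ s ⟨hne, hs, ⟨hγ, hv⟩ | ⟨hγ, hv⟩, htop, hbot⟩ c
    · exact NullDist.existsUnique_level_of_riemNorm_le_diff h h_complete hτ.1 hne hs hγ
        (hv.mono fun t ht ↦ ⟨ht.1, h_steep _ _ ht.2⟩) (hv.mono fun t ht ↦ ht.2.1.2)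
        htop hbot c
    -- A past-directed curve keeps its parametrization and `-τ` replaces `τ`: steepness is applied
    -- to the negated velocity, and the level becomes `-c`.
    · have h1 := NullDist.existsUnique_level_of_riemNorm_le_diff h h_complete
        (τ := fun x ↦ - τ x) hτ.1.neg hne hs hγ
        (hv.mono fun t ht ↦ ⟨ht.1, by
          rw [NullDist.Spacetime.diff_neg_left, ← NullDist.Spacetime.riemNorm_neg]
          exact h_steep _ _ ht.2.neg⟩) (hv.mono fun t ht ↦ ht.2.1.2)
        htop hbot (-c)
      simpa only [neg_inj] using h1
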